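/- Let $R$ be a commutative artinian ring and let $\mathcal C$ be a dualizing $R$-variety: a small additive $R$-linear category in which idempotents split, whose Hom-modules are finitely generated over $R$, and for which $\mathbb D=\mathrm{Hom}_R(-,E)$, with $E$ the injective envelope of $R/\mathrm{rad}\,R$, restricts to a duality between $\mathrm{mod}(\mathcal C)$ and $\mathrm{mod}(\mathcal C^{op})$. Here $\mathrm{Mod}(\mathcal C)$ is the category of $R$-linear functors $\mathcal C\to \mathrm{Mod}(R)$, and $\mathrm{mod}(\mathcal C)$ is its full subcategory of finitely presented functors, i.e. of those $M$ with an exact sequence $\mathrm{Hom}_{\mathcal C}(C_0,-)\to\mathrm{Hom}_{\mathcal C}(C_1,-)\to M\to 0$; it is an abelian category. Let $C\in\mathcal C$, $P=\mathrm{Hom}_{\mathcal C}(C,-)$, $R_P=\mathrm{End}_{\mathrm{mod}(\mathcal C)}(P)^{op}$, write $(P,-)=\mathrm{Hom}_{\mathrm{mod}(\mathcal C)}(P,-)$ for the exact functor from $\mathrm{mod}(\mathcal C)$ to left $R_P$-modules, and let $J$ be the injective envelope of $P/\mathrm{rad}(P)$ in $\mathrm{mod}(\mathcal C)$, where $\mathrm{rad}(P)$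 is the intersection of the maximal submodules of $P$. For an object $Q$ let $\mathrm{add}(Q)$ denote the class of direct summands of finite direct sums of copies of $Q$. For $0\le k\le\infty$ let * $\mathbb P_k$ be the class of all $X\in\mathrm{mod}(\mathcal C)$ having a projective resolution $\cdots\to P_1\to P_0\to X\to 0$ in $\mathrm{mod}(\mathcal C)$ with $P_i\in\mathrm{add}(P)$ for all $0\le i\le k$; * $\mathbb I_k$ be the class of all $Y\in\mathrm{mod}(\mathcal C)$ having an injective coresolution $0\to Y\to J_0\to J_1\to\cdots$ in $\mathrm{mod}(\mathcal C)$ with $J_i\in\mathrm{add}(J)$ for all $0\le i\le k$ (for $k=\infty$ the condition is required for all finite $i\ge 0$). Let $X,Y\in\mathrm{mod}(\mathcal C)$ and $n\ge 0$. Then the canonical map $$\Phi^n_{X,Y}:\mathrm{Ext}^n_{\mathrm{mod}(\mathcal C)}(X,Y)\longrightarrow \mathrm{Ext}^n_{R_P}\big((P,X),(P,Y)\big)$$ induced by the exact functor $(P,-)$ is an isomorphism in each of the following three cases: (a) $X\in\mathbb P_i$ and $Y\in\mathbb I_j$ for some $0\le i,j\le\infty$ with $n\le i+j$; (b) $Y\in\mathbb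 I_{n+1}$ (and $X$ is arbitrary); (c) $X\in\mathbb P_{n+1}$ (and $Y$ is arbitrary). -/

import Mathlib

open CategoryTheory CategoryTheory.Limits Opposite
open scoped ZeroObject

universe u v w w'

noncomputable section

namespace DualVar

section Modules

variable (R : Type v) [CommRing R] (C : Type u) [Category.{v} C] [Preadditive C] [Linear R C]

/-- The opposite of an `R`-linear category, with `Cᵒᵖ(x, y) = C(y, x)` as `R`-modules. -/
instance linearOpposite : Linear R Cᵒᵖ where
  homModule X Y := Equiv.module R (opEquiv X Y)
  smul_comp _ _ _ r f g := Quiver.Hom.unop_inj (Linear.comp_smul _ _ _ g.unop r f.unop)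
  comp_smul _ _ _ f r g := Quiver.Hom.unop_inj (Linear.smul_comp _ _ _ r g.unop f.unop)

/-- `C`-modules: additive functors `C ⥤ Ab`, identified with `R`-linear (additive) functors
`C ⥤ ModuleCat R`. -/
def isModule : ObjectProperty (C ⥤ ModuleCat.{v} R) := fun F => F.Additive ∧ F.Linear R

/-- The category `Mod(C)` of all (covariant) `C`-modules. -/
abbrev CMod : Type (max u (v + 1)) := (isModule R C).FullSubcategory

instance : (isModule R C).IsClosedUnderIsomorphisms where
  of_iso {F G} e h := by
    obtain ⟨h1, h2⟩ := h
    exact ⟨Functor.additive_of_iso e, Functor.linear_of_iso R e⟩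

instance : (isModule R C).IsClosedUnderSubobjects where
  prop_of_mono {F G} i _ h := by
    obtain ⟨h1, h2⟩ := h
    have := (NatTrans.mono_iff_mono_app i).1 inferInstance
    refine ⟨⟨fun {X Y f g} => ?_⟩, ⟨fun {X Y} f r => ?_⟩⟩
    · rw [← cancel_mono (i.app Y)]; simp
    · rw [← cancel_mono (i.app Y)]; simp

instance : (isModule R C).IsClosedUnderQuotients where
  prop_of_epi {F G} p _ h := by
    obtain ⟨h1, h2⟩ := h
    have := (NatTrans.epi_iff_epi_app p).1 inferInstance
    refine ⟨⟨fun {X Y f g} => ?_⟩, ⟨fun {X Y} f r => ?_⟩⟩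
    · rw [← cancel_epi (p.app X)]; simp [← NatTrans.naturality]
    · rw [← cancel_epi (p.app X)]; simp [← NatTrans.naturality]

instance : (isModule R C).ContainsZero where
  exists_zero := ⟨(0 : C ⥤ ModuleCat R), isZero_zero _,
    ⟨fun {X _ _ _} => (((isZero_zero (C ⥤ ModuleCat R)).obj X)).eq_of_src _ _⟩,
    ⟨fun {X _} _ _ => (((isZero_zero (C ⥤ ModuleCat R)).obj X)).eq_of_src _ _⟩⟩

instance : (isModule R C).IsClosedUnderFiniteProducts where
  isClosedUnderLimitsOfShape J _ := ⟨by
    rintro F ⟨p⟩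
    have key (Y : C) {A : ModuleCat R} (a b : A ⟶ F.obj Y)
        (h : ∀ j, a ≫ (p.π.app j).app Y = b ≫ (p.π.app j).app Y) : a = b :=
      (isLimitOfPreserves ((evaluation C (ModuleCat R)).obj Y) p.isLimit).hom_ext h
    have h1 (j) : (p.diag.obj j).Additive := (p.prop_diag_obj j).1
    have h2 (j) : (p.diag.obj j).Linear R := (p.prop_diag_obj j).2
    refine ⟨⟨fun {X Y f g} => key _ _ _ fun j => ?_⟩, ⟨fun {X Y} f r => key _ _ _ fun j => ?_⟩⟩
    · simp
    · simp⟩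

variable {C}

/-- The representable `C`-module `Hom_C(c, -)`. -/
def rep (c : C) : CMod R C :=
  ⟨(linearCoyoneda R C).obj (op c), inferInstance,
    ⟨fun f r => by ext g; exact Linear.comp_smul _ _ _ g r f⟩⟩

variable {R}

/-- Yoneda: the morphism `Hom_C(c, -) ⟶ M` attached to an element of `M(c)`. -/
def repHom {M : CMod R C} {c : C} (x : M.obj.obj c) : rep R c ⟶ M :=
  ObjectProperty.homMk
    { app := fun d => ModuleCat.ofHom
        { toFun := fun g : c ⟶ d => (M.obj.map g).hom x
          map_add' := fun f g => by
            have := M.property.1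
            simp [Functor.map_add]
          map_smul' := fun r f => by
            have := M.property.1
            have := M.property.2
            simp [Functor.map_smul] }
      naturality := fun d d' g => by
        ext f
        exact (congrArg (fun t => t.hom x) (M.obj.map_comp (f : c ⟶ d) g)) }

/-- Yoneda: the element of `M(c)` attached to a morphism `Hom_C(c, -) ⟶ M`. -/
def repVal {M : CMod R C} {c : C} (f : rep R c ⟶ M) : M.obj.obj c :=
  (f.hom.app c).hom (𝟙 c : c ⟶ c)

lemma repVal_repHom {M : CMod R C} {c : C} (x : M.obj.obj c) : repVal (repHom x) = x :=
  congrArg (fun t => t.hom x) (M.obj.map_id c)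

lemma repHom_repVal {M : CMod R C} {c : C} (f : rep R c ⟶ M) : repHom (repVal f) = f := by
  apply ObjectProperty.hom_ext
  ext d (g : c ⟶ d)
  have h := congrArg (fun t => t.hom (𝟙 c : c ⟶ c)) (f.hom.naturality g)
  have h2 : (𝟙 c : c ⟶ c) ≫ g = g := Category.id_comp g
  refine h.symm.trans ?_
  exact congrArg (fun t => (f.hom.app d).hom t) h2

lemma rep_hom_ext {M : CMod R C} {c : C} {f g : rep R c ⟶ M} (h : repVal f = repVal g) : f = g := by
  rw [← repHom_repVal f, ← repHom_repVal g, h]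

lemma repVal_comp {M N : CMod R C} {c : C} (f : rep R c ⟶ M) (g : M ⟶ N) :
    repVal (f ≫ g) = (g.hom.app c).hom (repVal f) := rfl

lemma surjective_of_epi {M N : CMod R C} (p : M ⟶ N) [Epi p] (c : C) :
    Function.Surjective (p.hom.app c).hom := by
  have := (isModule R C).preservesEpimorphisms_ι_of_isNormalMonoCategory
  have h : Epi ((isModule R C).ι.map p) := inferInstance
  have := (NatTrans.epi_iff_epi_app _).1 h c
  exact (ModuleCat.epi_iff_surjective _).1 this

instance (c : C) : Projective (rep R c) where
  factors {M N} f p _ := by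
    obtain ⟨x, hx⟩ := surjective_of_epi p c (repVal f)
    exact ⟨repHom x, rep_hom_ext (by rw [repVal_comp, repVal_repHom, hx])⟩

variable (R C)

/-- `M` is finitely presented: there is an exact sequence
`Hom_C(c₀, -) ⟶ Hom_C(c₁, -) ⟶ M ⟶ 0` in `Mod(C)`. -/
def isFinitelyPresented : ObjectProperty (CMod R C) := fun M =>
  ∃ (c₀ c₁ : C) (f : rep R c₀ ⟶ rep R c₁) (p : rep R c₁ ⟶ M) (w : f ≫ p = 0),
    (ShortComplex.mk f p w).Exact ∧ Epi p

/-- The category `mod(C)`: the full subcategory of `Mod(C)` on the finitely presented modules. -/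
abbrev FPMod : Type (max u (v + 1)) := (isFinitelyPresented R C).FullSubcategory

variable {R C}

lemma isFinitelyPresented_iff (M : CMod R C) : isFinitelyPresented R C M ↔
    ∃ (c₀ c₁ : C) (f : rep R c₀ ⟶ rep R c₁) (p : rep R c₁ ⟶ M) (w : f ≫ p = 0),
      Nonempty (IsColimit (CokernelCofork.ofπ p w)) := by
  constructor
  · rintro ⟨c₀, c₁, f, p, w, h⟩
    exact ⟨c₀, c₁, f, p, w, (ShortComplex.mk f p w).exact_and_epi_g_iff_g_is_cokernel.1 h⟩
  · rintro ⟨c₀, c₁, f, p, w, h⟩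
    exact ⟨c₀, c₁, f, p, w, (ShortComplex.mk f p w).exact_and_epi_g_iff_g_is_cokernel.2 h⟩

lemma isFinitelyPresented_of_fac {M : CMod R C} {c₀ c₁ : C} (f : rep R c₀ ⟶ rep R c₁)
    (p : rep R c₁ ⟶ M) (w : f ≫ p = 0) [Epi p]
    (h : ∀ {T : CMod R C} (t : rep R c₁ ⟶ T), f ≫ t = 0 → ∃ t', p ≫ t' = t) :
    isFinitelyPresented R C M :=
  (isFinitelyPresented_iff M).2 ⟨c₀, c₁, f, p, w,
    ⟨CokernelCofork.IsColimit.ofπ _ _ (fun t ht => (h t ht).choose)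
      (fun t ht => (h t ht).choose_spec)
      (fun t ht b hb => by rw [← cancel_epi p, hb, (h t ht).choose_spec])⟩⟩

lemma exists_fac {M : CMod R C} (h : isFinitelyPresented R C M) :
    ∃ (c₀ c₁ : C) (f : rep R c₀ ⟶ rep R c₁) (p : rep R c₁ ⟶ M), f ≫ p = 0 ∧ Epi p ∧
    ∀ {T : CMod R C} (t : rep R c₁ ⟶ T), f ≫ t = 0 → ∃ t', p ≫ t' = t := by
  obtain ⟨c₀, c₁, f, p, w, h, hp⟩ := h
  obtain ⟨l⟩ := (ShortComplex.mk f p w).exact_and_epi_g_iff_g_is_cokernel.1 ⟨h, hp⟩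
  exact ⟨c₀, c₁, f, p, w, hp, fun t ht =>
    ⟨l.desc (CokernelCofork.ofπ t ht), l.fac _ WalkingParallelPair.one⟩⟩

instance : (isFinitelyPresented R C).IsClosedUnderIsomorphisms where
  of_iso {M N} e h := by
    obtain ⟨c₀, c₁, f, p, w, hp, h⟩ := exists_fac h
    refine isFinitelyPresented_of_fac f (p ≫ e.hom) (by simp [reassoc_of% w]) fun t ht => ?_
    obtain ⟨t', rfl⟩ := h t ht
    exact ⟨e.inv ≫ t', by simp⟩


/-- The morphism `Hom_C(d, -) ⟶ Hom_C(c, -)` given by precomposition with `f : c ⟶ d`. -/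
def repMap {c d : C} (f : c ⟶ d) : rep R d ⟶ rep R c := repHom (M := rep R c) f

lemma repVal_repMap_comp {c d : C} (f : c ⟶ d) {M : CMod R C} (g : rep R c ⟶ M) :
    repVal (repMap f ≫ g) = (M.obj.map f).hom (repVal g) := by
  have h := congrArg (fun t => t.hom (𝟙 c : c ⟶ c)) (g.hom.naturality f)
  refine Eq.trans ?_ h
  refine (repVal_comp _ _).trans ?_
  refine congrArg (fun t => (g.hom.app d).hom t) ((repVal_repHom (M := rep R c) _).trans ?_)
  exact (Category.id_comp f).symm

lemma repMap_comp {c d e : C} (f : c ⟶ d) (g : d ⟶ e) :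
    repMap (R := R) g ≫ repMap f = repMap (f ≫ g) := by
  apply rep_hom_ext
  rw [repVal_repMap_comp]
  refine (congrArg (fun t => (((rep R c).obj.map g).hom t)) (repVal_repHom (M := rep R c) f)).trans ?_
  exact (repVal_repHom (M := rep R c) (f ≫ g)).symm

lemma repMap_id (c : C) : repMap (R := R) (𝟙 c) = 𝟙 _ :=
  rep_hom_ext (repVal_repHom (M := rep R c) _)

lemma repMap_add {c d : C} (f g : c ⟶ d) :
    repMap (R := R) (f + g) = repMap f + repMap g := by
  apply rep_hom_ext
  refine (repVal_repHom (M := rep R c) _).trans ?_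
  exact (congrArg₂ (· + ·) (repVal_repHom (M := rep R c) f) (repVal_repHom (M := rep R c) g)).symm

lemma repMap_zero (c d : C) : repMap (R := R) (0 : c ⟶ d) = 0 :=
  rep_hom_ext (repVal_repHom (M := rep R c) _)

/-- The Yoneda embedding turns biproducts into biproducts. -/
def repBiprod (c d : C) [HasBinaryBiproduct c d] : rep R (c ⊞ d) ≅ rep R c ⊞ rep R d where
  hom := biprod.lift (repMap biprod.inl) (repMap biprod.inr)
  inv := biprod.desc (repMap biprod.fst) (repMap biprod.snd)
  hom_inv_id := by
    rw [biprod.lift_desc, repMap_comp, repMap_comp, ← repMap_add, biprod.total, repMap_id]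
  inv_hom_id := by
    apply biprod.hom_ext <;> apply biprod.hom_ext' <;> simp [repMap_comp, repMap_id, repMap_zero]

variable [HasFiniteBiproducts C]

instance : HasFiniteBiproducts Cᵒᵖ := HasFiniteBiproducts.of_hasFiniteProducts

instance : (isFinitelyPresented R C).ContainsZero where
  exists_zero := by
    have hz : IsZero (rep R (0 : C)) := by
      refine (IsZero.iff_id_eq_zero _).2 (rep_hom_ext ?_)
      exact (isZero_zero C).eq_of_src _ _
    refine ⟨_, hz, isFinitelyPresented_of_fac (𝟙 (rep R (0 : C))) (𝟙 _) (hz.eq_of_src _ _)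
      fun t _ => ⟨t, by simp⟩⟩


lemma isFinitelyPresented_biprod {M N : CMod R C} (hM : isFinitelyPresented R C M)
    (hN : isFinitelyPresented R C N) : isFinitelyPresented R C (M ⊞ N) := by
  have := hasBinaryBiproducts_of_finite_biproducts C
  obtain ⟨c₀, c₁, f, p, w, hp, h⟩ := exists_fac hM
  obtain ⟨d₀, d₁, g, q, z, hq, h'⟩ := exists_fac hN
  refine isFinitelyPresented_of_fac
    ((repBiprod c₀ d₀).hom ≫ biprod.map f g ≫ (repBiprod c₁ d₁).inv)
    ((repBiprod c₁ d₁).hom ≫ biprod.map p q) (by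
      simp only [Category.assoc, Iso.inv_hom_id_assoc]
      have : biprod.map f g ≫ biprod.map p q = 0 := by
        apply biprod.hom_ext <;> apply biprod.hom_ext' <;> simp [w, z]
      rw [this, comp_zero]) fun t ht => ?_
  have ht' : biprod.map f g ≫ (repBiprod c₁ d₁).inv ≫ t = 0 := by
    rw [← cancel_epi (repBiprod c₀ d₀).hom]; simpa using ht
  obtain ⟨a, ha⟩ := h (biprod.inl ≫ (repBiprod c₁ d₁).inv ≫ t) (by
    simpa using biprod.inl ≫= ht')
  obtain ⟨b, hb⟩ := h' (biprod.inr ≫ (repBiprod c₁ d₁).inv ≫ t) (by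
    simpa using biprod.inr ≫= ht')
  refine ⟨biprod.desc a b, ?_⟩
  rw [← cancel_epi (repBiprod c₁ d₁).inv]
  apply biprod.hom_ext' <;> simp [ha, hb]

instance : (isFinitelyPresented R C).IsClosedUnderBinaryProducts where
  limitsOfShape_le := by
    rintro M ⟨p⟩
    refine ObjectProperty.prop_of_iso _ ?_ (isFinitelyPresented_biprod
      (p.prop_diag_obj ⟨.left⟩) (p.prop_diag_obj ⟨.right⟩))
    exact (BinaryBiproduct.isLimit _ _).conePointsIsoOfNatIso p.isLimit (diagramIsoPair p.diag).symm

instance : (isFinitelyPresented R C).IsClosedUnderFiniteProducts :=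
  ObjectProperty.IsClosedUnderFiniteProducts.mk'

instance : (isFinitelyPresented R C).IsClosedUnderCokernels where
  cokernels_le := by
    rintro _ ⟨f, k, hk, hM, hN⟩
    have := hasBinaryBiproducts_of_finite_biproducts C
    obtain ⟨c₀, c₁, a, p, w, hp, -⟩ := exists_fac hM
    obtain ⟨d₀, d₁, b, q, z, hq, h⟩ := exists_fac hN
    have hk' : Epi k.π := Cofork.IsColimit.epi hk
    let l : rep R c₁ ⟶ rep R d₁ := Projective.factorThru (p ≫ f) q
    have hl : l ≫ q = p ≫ f := Projective.factorThru_comp _ _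
    refine isFinitelyPresented_of_fac ((repBiprod d₀ c₁).hom ≫ biprod.desc b l) (q ≫ k.π) ?_
      fun t ht => ?_
    · rw [Category.assoc]
      have : biprod.desc b l ≫ q ≫ k.π = 0 := by
        apply biprod.hom_ext'
        · simp [reassoc_of% z]
        · simp [reassoc_of% hl]
      rw [this, comp_zero]
    · have ht' : biprod.desc b l ≫ t = 0 := by
        rw [← cancel_epi (repBiprod d₀ c₁).hom]; simpa using ht
      obtain ⟨t', rfl⟩ := h t (by simpa using biprod.inl ≫= ht')
      have h2 : f ≫ t' = 0 := by
        rw [← cancel_epi p, ← reassoc_of% hl]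
        simpa using biprod.inr ≫= ht'
      exact ⟨hk.desc (CokernelCofork.ofπ t' h2), by
        rw [Category.assoc]; congr 1; exact hk.fac _ WalkingParallelPair.one⟩

end Modules

/-- `N` is the radical of `M`: the intersection of the maximal submodules of `M`. -/
def IsRad {R : Type v} [CommRing R] {C : Type u} [Category.{v} C] [Preadditive C]
    [Linear R C] (M : CMod R C) (N : Subobject M) : Prop :=
  IsGLB {K : Subobject M | IsCoatom K} N

section Duality

variable (R : Type v) [CommRing R] (C : Type u) [Category.{v} C] [Preadditive C] [Linear R C]

/-- The contravariant functor `M ↦ (c ↦ Hom_R(M(c), E))` from `C`-modules to `Cᵒᵖ`-modules. -/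
def dual (E : ModuleCat.{v} R) : (CMod R C)ᵒᵖ ⥤ CMod R Cᵒᵖ :=
  (isModule R Cᵒᵖ).lift
    ((isModule R C).ι.op ⋙ Functor.opHom C (ModuleCat.{v} R) ⋙
      (Functor.whiskeringRight _ _ _).obj ((linearYoneda R (ModuleCat.{v} R)).obj E))
    (fun M => by
      obtain ⟨h₁, h₂⟩ := M.unop.property
      refine ⟨⟨fun {X Y f g} => ?_⟩, ⟨fun {X Y} f r => ?_⟩⟩
      · ext (t : M.unop.obj.obj X.unop ⟶ E)
        change M.unop.obj.map (f.unop + g.unop) ≫ t =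
          M.unop.obj.map f.unop ≫ t + M.unop.obj.map g.unop ≫ t
        rw [Functor.map_add, Preadditive.add_comp]
      · ext (t : M.unop.obj.obj X.unop ⟶ E)
        change M.unop.obj.map (r • f.unop) ≫ t = r • (M.unop.obj.map f.unop ≫ t)
        rw [Functor.map_smul, Linear.smul_comp])

/-- `i : X ⟶ J` is an injective envelope of `X`: `J` is injective and `i` is an essential
monomorphism. -/
structure IsInjectiveEnvelope {A : Type*} [Category* A] {X J : A} (i : X ⟶ J) : Prop where
  injective : Injective J
  mono : Mono i
  essential : ∀ ⦃Z : A⦄ (g : J ⟶ Z), Mono (i ≫ g) → Mono g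

/-- A Hom-finite `R`-variety: an additive `R`-linear category in which idempotents split and whose
Hom-modules are finitely generated over `R`. -/
class IsHomFiniteVariety : Prop where
  hasFiniteBiproducts : HasFiniteBiproducts C
  isIdempotentComplete : IsIdempotentComplete C
  finite_hom (c d : C) : Module.Finite R (c ⟶ d)

/-- A dualizing `R`-variety: a Hom-finite `R`-variety such that `D = Hom_R(-, E)`, where `E` is the
injective envelope of `R / rad R`, sends `mod(C)` into `mod(Cᵒᵖ)` and the functor
`mod(C)ᵒᵖ ⥤ mod(Cᵒᵖ)` so obtained is an equivalence. -/
class IsDualizingVariety : Prop extends IsHomFiniteVariety R C where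
  exists_duality : ∃ (E : ModuleCat.{v} R) (i : ModuleCat.of R (R ⧸ Ring.jacobson R) ⟶ E)
    (h : ∀ M : (FPMod R C)ᵒᵖ,
      isFinitelyPresented R Cᵒᵖ (((isFinitelyPresented R C).ι.op ⋙ dual R C E).obj M)),
    IsInjectiveEnvelope i ∧
    ((isFinitelyPresented R Cᵒᵖ).lift ((isFinitelyPresented R C).ι.op ⋙ dual R C E) h).IsEquivalence

variable {R C} in
lemma isFinitelyPresented_rep [HasFiniteBiproducts C] (c : C) :
    isFinitelyPresented R C (rep R c) :=
  isFinitelyPresented_of_fac (0 : rep R c ⟶ rep R c) (𝟙 _) (by simp) fun t _ => ⟨t, by simp⟩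


variable {R C} in
lemma mod_hom_ext {M N : CMod R C} {f g : M ⟶ N}
    (h : ∀ (c : C) (x : rep R c ⟶ M), x ≫ f = x ≫ g) : f = g := by
  apply ObjectProperty.hom_ext
  ext c x
  have := congrArg repVal (h c (repHom x))
  rwa [repVal_comp, repVal_comp, repVal_repHom] at this

variable [IsDualizingVariety R C]

lemma hasEqualizers_mod : HasEqualizers (FPMod R C) := by
  obtain ⟨E, -, h, -, he⟩ := IsDualizingVariety.exists_duality (R := R) (C := C)
  have : HasFiniteBiproducts C := IsHomFiniteVariety.hasFiniteBiproducts R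
  have : HasCoequalizers (FPMod R Cᵒᵖ) := Preadditive.hasCoequalizers_of_hasCokernels
  have : HasCoequalizers (FPMod R C)ᵒᵖ := Adjunction.hasColimitsOfShape_of_equivalence
    ((isFinitelyPresented R Cᵒᵖ).lift ((isFinitelyPresented R C).ι.op ⋙ dual R C E) h)
  have : HasEqualizers (FPMod R C)ᵒᵖᵒᵖ := inferInstance
  exact Adjunction.hasLimitsOfShape_of_equivalence (opOpEquivalence (FPMod R C)).inverse

instance : (isFinitelyPresented R C).IsClosedUnderKernels where
  kernels_le := by
    rintro _ ⟨f, k, hk, hM, hN⟩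
    have := hasEqualizers_mod R C
    have : HasFiniteBiproducts C := IsHomFiniteVariety.hasFiniteBiproducts R
    have hk' : Mono k.ι := Fork.IsLimit.mono hk
    let f' : (⟨_, hM⟩ : FPMod R C) ⟶ ⟨_, hN⟩ := ObjectProperty.homMk f
    let j : (kernel f').obj ⟶ _ := (kernel.ι f').hom
    have hj : j ≫ f = 0 := congrArg (fun t => t.hom) (kernel.condition f')
    let φ : (kernel f').obj ⟶ k.pt := hk.lift (KernelFork.ofι j hj)
    have hφ : φ ≫ k.ι = j := hk.fac _ WalkingParallelPair.zero
    have h1 : Mono φ := Preadditive.mono_of_cancel_zero _ fun {T} t ht => mod_hom_ext fun c x => by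
      let y : (⟨rep R c, isFinitelyPresented_rep c⟩ : FPMod R C) ⟶ kernel f' :=
        ObjectProperty.homMk (x ≫ t)
      have hy : y = 0 := by
        rw [← cancel_mono (kernel.ι f'), zero_comp]
        apply ObjectProperty.hom_ext
        change (x ≫ t) ≫ j = 0
        rw [← hφ, Category.assoc, reassoc_of% ht, zero_comp, comp_zero]
      rw [comp_zero]
      exact congrArg (fun t => t.hom) hy
    have h2 : Epi φ := Preadditive.epi_of_cancel_zero _ fun {T} s hs => mod_hom_ext fun c x => by
      let y : (⟨rep R c, isFinitelyPresented_rep c⟩ : FPMod R C) ⟶ ⟨_, hM⟩ :=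
        ObjectProperty.homMk (x ≫ k.ι)
      have hy : y ≫ f' = 0 := by
        apply ObjectProperty.hom_ext
        change (x ≫ k.ι) ≫ f = 0
        rw [Category.assoc, KernelFork.condition, comp_zero]
      have hu : (kernel.lift f' y hy).hom ≫ φ = x := by
        rw [← cancel_mono k.ι, Category.assoc, hφ]
        exact congrArg (fun t => t.hom) (kernel.lift_ι f' y hy)
      rw [← hu, Category.assoc, hs]
      simp
    have := isIso_of_mono_of_epi φ
    exact ObjectProperty.prop_of_iso _ (asIso φ) (kernel f').property

/-- For a dualizing variety `C`, the full subcategory `mod(C)` of `Mod(C)` is closed under finite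
products, kernels and cokernels, hence abelian. -/
instance modAbelian : Abelian (FPMod R C) :=
  have : HasFiniteBiproducts C := IsHomFiniteVariety.hasFiniteBiproducts R
  inferInstance

instance : HasFiniteBiproducts (FPMod R C) := Abelian.hasFiniteBiproducts

variable {C}

/-- The projective `P = Hom_C(c, -)`, as an object of `mod(C)`. -/
def proj (c : C) : FPMod R C :=
  have : HasFiniteBiproducts C := IsHomFiniteVariety.hasFiniteBiproducts R
  ⟨rep R c, isFinitelyPresented_rep c⟩

instance (c : C) : Projective (proj R c) where
  factors {M N} f p _ := by
    have : HasFiniteBiproducts C := IsHomFiniteVariety.hasFiniteBiproducts R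
    have := (isFinitelyPresented R C).preservesEpimorphisms_ι_of_isNormalMonoCategory
    have h : Epi p.hom := inferInstanceAs (Epi ((isFinitelyPresented R C).ι.map p))
    have : Projective (proj R c).obj := inferInstanceAs (Projective (rep R c))
    exact ⟨ObjectProperty.homMk (Projective.factorThru f.hom p.hom),
      ObjectProperty.hom_ext _ (Projective.factorThru_comp f.hom p.hom)⟩

/-- The ring `R_P = End_{mod(C)}(P)ᵒᵖ` for `P = Hom_C(c, -)`. -/
abbrev endRing (c : C) : Type (max u v) := (End (proj R c))ᵐᵒᵖ

/-- The functor `Hom_{mod(C)}(P, -)` from `mod(C)` to left `R_P`-modules, `P = Hom_C(c, -)`. -/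
abbrev homFrom (c : C) : FPMod R C ⥤ ModuleCat.{max u v} (endRing R c) :=
  preadditiveCoyonedaObj (proj R c)

/-- The canonical map `Φⁿ : Extⁿ_{mod(C)}(X, Y) → Extⁿ_{R_P}((P, X), (P, Y))` induced by the exact
functor `(P, -)`. Both `Ext` groups are Mathlib's; the `HasExt` binders only choose the universes in
which these groups are realized. -/
def extMap [HasExt.{w} (FPMod R C)] (c : C) [HasExt.{w'} (ModuleCat.{max u v} (endRing R c))]
    (X Y : FPMod R C) (n : ℕ) :
    Abelian.Ext.{w} X Y n →+ Abelian.Ext.{w'} ((homFrom R c).obj X) ((homFrom R c).obj Y) n :=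
  (homFrom R c).mapExtAddHom X Y n

variable {R}

/-- `X ∈ add(P)`: `X` is a direct summand of a finite direct sum of copies of `P`. -/
def IsInAdd (P X : FPMod R C) : Prop :=
  ∃ n : ℕ, Nonempty (Retract X (⨁ fun _ : Fin n => P))

/-- The class `ℙ_k` of the modules `X` in `mod(C)` having a projective resolution
`⋯ ⟶ P₁ ⟶ P₀ ⟶ X ⟶ 0` with `P_i ∈ add(P)` for all `0 ≤ i ≤ k` (with `0 ≤ k ≤ ∞`). -/
def projClass (P : FPMod R C) (k : ℕ∞) : ObjectProperty (FPMod R C) := fun X =>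
  ∃ Q : ProjectiveResolution X, ∀ i : ℕ, (i : ℕ∞) ≤ k → IsInAdd P (Q.complex.X i)

/-- `J` is the injective envelope in `mod(C)` of `P / rad P`. -/
def IsInjectiveEnvelopeOfTop (P J : FPMod R C) : Prop :=
  ∃ N : Subobject P.obj, IsRad P.obj N ∧
    ∃ (T : FPMod R C) (_ : T.obj ≅ cokernel N.arrow) (i : T ⟶ J), IsInjectiveEnvelope i

/-- The class `𝕀_k` of the modules `Y` in `mod(C)` having an injective coresolution
`0 ⟶ Y ⟶ J₀ ⟶ J₁ ⟶ ⋯` with `J_i ∈ add(J)` for all `0 ≤ i ≤ k` (with `0 ≤ k ≤ ∞`), where `J` is the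
injective envelope of `P / rad P`. -/
def injClass (P : FPMod R C) (k : ℕ∞) : ObjectProperty (FPMod R C) := fun Y =>
  ∃ J : FPMod R C, IsInjectiveEnvelopeOfTop P J ∧
    ∃ I : InjectiveResolution Y, ∀ i : ℕ, (i : ℕ∞) ≤ k → IsInAdd J (I.cocomplex.X i)

end Duality

end DualVar

end

/-! Write F for the exact functor (P,-). The theorem is a dimension shift resting on two classes of
objects for which F is bijective on all Ext groups. Out of add(P): F(P) is the regular R_P-module,
so Yoneda handles Hom, and both sides vanish in positive degrees by projectivity. Into add(J):
applying the duality to Hom(-,c) gives an object I of mod(C) with Hom(M,I) = Hom_R(M(c),E) naturally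
in M (`exists_corepresents`). Thus I is injective, and F(I) is the coinduced module Hom_R(R_P,E);
this makes F(I) injective and F bijective on Hom(M,I). It remains to see that J lies in add(I). A
nonzero submodule of P/rad P is nonzero at c, and the value of P/rad P at c is an artinian R-module
separated by maps to E, so finitely many maps to I embed P/rad P in a power of I. Essentiality
carries this embedding over to J, which then splits off. If X has a add(P)-terms of resolution and Y
has b add(J)-terms of coresolution, four-lemma arguments show that F is injective on Extⁿ(X,Y) for n
+ 1 ≤ a + b and surjective for n + 2 ≤ a + b (`mapExt_injective_and_surjective`). The three cases of
the theorem are (a,b) = (i+1,j+1), (0,n+2) and (n+2,0), with infinite i or j first cut down to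
finite bounds. -/

noncomputable section

namespace DualVar

open Abelian

/-! ### Partial resolutions and dimension shifting along an exact functor. -/

section Homological

universe u₁ v₁ u₂ v₂

variable {A : Type u₁} [Category.{v₁} A] [Abelian A]

/-- `X` admits a partial resolution `Q_{k-1} ⟶ ⋯ ⟶ Q₀ ⟶ X ⟶ 0` with all `Q_i` in `𝒬`. -/
def HasLeftResolution (𝒬 : ObjectProperty A) : ℕ → A → Prop
  | 0, _ => True
  | k + 1, X => ∃ S : ShortComplex A, S.ShortExact ∧ 𝒬 S.X₂ ∧ S.X₃ = X ∧
      HasLeftResolution 𝒬 k S.X₁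

/-- `Y` admits a partial coresolution `0 ⟶ Y ⟶ J₀ ⟶ ⋯ ⟶ J_{k-1}` with all `J_i` in `𝒥`. -/
def HasRightResolution (𝒥 : ObjectProperty A) : ℕ → A → Prop
  | 0, _ => True
  | k + 1, Y => ∃ S : ShortComplex A, S.ShortExact ∧ 𝒥 S.X₂ ∧ S.X₁ = Y ∧
      HasRightResolution 𝒥 k S.X₃

/-- The kernel of π is resolved by the tail of the sequence. Bare exact sequences are used, rather
than projective resolutions, so that the induction applies to this tail. -/
lemma HasLeftResolution.of_exact {𝒬 : ObjectProperty A} (k : ℕ) : ∀ {Z : A} {X : ℕ → A}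
    (d : ∀ n, X (n + 1) ⟶ X n) (π : X 0 ⟶ Z) [Epi π] (w : d 0 ≫ π = 0)
    (_ : (ShortComplex.mk _ _ w).Exact) (wd : ∀ n, d (n + 1) ≫ d n = 0)
    (_ : ∀ n, (ShortComplex.mk _ _ (wd n)).Exact) (_ : ∀ i < k, 𝒬 (X i)),
    HasLeftResolution 𝒬 k Z := by
  induction k with
  | zero => intros; trivial
  | succ k ih =>
    intro Z X d π _ w h wd hd hX
    refine ⟨ShortComplex.mk _ _ (kernel.condition π), { exact := ShortComplex.exact_kernel π },
      hX 0 (by omega), rfl, ?_⟩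
    have : Epi (kernel.lift π (d 0) w) := (ShortComplex.exact_iff_epi_kernel_lift _).1 h
    have w' : d 1 ≫ kernel.lift π (d 0) w = 0 := by
      rw [← cancel_mono (kernel.ι π)]; simpa using wd 0
    refine ih (X := fun n => X (n + 1)) (fun n => d (n + 1)) (kernel.lift π (d 0) w) w' ?_
      (fun n => wd (n + 1)) (fun n => hd (n + 1)) (fun i hi => hX (i + 1) (by omega))
    -- Composing the augmentation of the tail with the monomorphism ker π ⟶ X 0 leaves its kernel
    -- unchanged, so exactness transfers.
    let φ : ShortComplex.mk _ _ w' ⟶ ShortComplex.mk _ _ (wd 0) :=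
      { τ₁ := 𝟙 _, τ₂ := 𝟙 _, τ₃ := kernel.ι π }
    have : Epi φ.τ₁ := inferInstanceAs (Epi (𝟙 _))
    have : IsIso φ.τ₂ := inferInstanceAs (IsIso (𝟙 _))
    have : Mono φ.τ₃ := inferInstanceAs (Mono (kernel.ι π))
    exact (ShortComplex.exact_iff_of_epi_of_isIso_of_mono φ).2 (hd 0)

lemma HasRightResolution.of_exact {𝒥 : ObjectProperty A} (k : ℕ) : ∀ {Z : A} {X : ℕ → A}
    (d : ∀ n, X n ⟶ X (n + 1)) (i : Z ⟶ X 0) [Mono i] (w : i ≫ d 0 = 0)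
    (_ : (ShortComplex.mk _ _ w).Exact) (wd : ∀ n, d n ≫ d (n + 1) = 0)
    (_ : ∀ n, (ShortComplex.mk _ _ (wd n)).Exact) (_ : ∀ i < k, 𝒥 (X i)),
    HasRightResolution 𝒥 k Z := by
  induction k with
  | zero => intros; trivial
  | succ k ih =>
    intro Z X d i _ w h wd hd hX
    refine ⟨ShortComplex.mk _ _ (cokernel.condition i), { exact := ShortComplex.exact_cokernel i },
      hX 0 (by omega), rfl, ?_⟩
    have : Mono (cokernel.desc i (d 0) w) := (ShortComplex.exact_iff_mono_cokernel_desc _).1 h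
    have w' : cokernel.desc i (d 0) w ≫ d 1 = 0 := by
      rw [← cancel_epi (cokernel.π i)]; simpa using wd 0
    refine ih (X := fun n => X (n + 1)) (fun n => d (n + 1)) (cokernel.desc i (d 0) w) w' ?_
      (fun n => wd (n + 1)) (fun n => hd (n + 1)) (fun i hi => hX (i + 1) (by omega))
    let φ : ShortComplex.mk _ _ (wd 0) ⟶ ShortComplex.mk _ _ w' :=
      { τ₁ := cokernel.π i, τ₂ := 𝟙 _, τ₃ := 𝟙 _ }
    have : Epi φ.τ₁ := inferInstanceAs (Epi (cokernel.π i))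
    have : IsIso φ.τ₂ := inferInstanceAs (IsIso (𝟙 _))
    have : Mono φ.τ₃ := inferInstanceAs (Mono (𝟙 _))
    exact (ShortComplex.exact_iff_of_epi_of_isIso_of_mono φ).1 (hd 0)

lemma HasLeftResolution.of_projectiveResolution {𝒬 : ObjectProperty A} {X : A} (k : ℕ)
    (Q : ProjectiveResolution X) (h : ∀ i < k, 𝒬 (Q.complex.X i)) : HasLeftResolution 𝒬 k X :=
  @HasLeftResolution.of_exact _ _ _ 𝒬 k X Q.complex.X (fun n => Q.complex.d (n + 1) n) (Q.π.f 0)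
    (inferInstance : Epi (Q.π.f 0))
    Q.complex_d_comp_π_f_zero
    (ShortComplex.exact_of_g_is_cokernel _ Q.isColimitCokernelCofork) _ Q.exact_succ h

lemma HasRightResolution.of_injectiveResolution {𝒥 : ObjectProperty A} {Y : A} (k : ℕ)
    (I : InjectiveResolution Y) (h : ∀ i < k, 𝒥 (I.cocomplex.X i)) : HasRightResolution 𝒥 k Y :=
  @HasRightResolution.of_exact _ _ _ 𝒥 k Y I.cocomplex.X (fun n => I.cocomplex.d n (n + 1))
    (I.ι.f 0) (inferInstance : Mono (I.ι.f 0))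
    I.ι_f_zero_comp_complex_d
    (ShortComplex.exact_of_f_is_kernel _ I.isLimitKernelFork) _ I.exact_succ h

variable {B : Type u₂} [Category.{v₂} B] [Abelian B] (F : A ⥤ B) [F.Additive]
  [PreservesFiniteLimits F] [PreservesFiniteColimits F] [HasExt.{w} A] [HasExt.{w'} B]

/-! ### Four-lemma arguments for the contravariant long exact sequence. -/

section LeftDimensionShift

variable {S : ShortComplex A} (hS : S.ShortExact) (Y : A)
  (h₂ : ∀ n, Function.Bijective (F.mapExtAddHom S.X₂ Y n))
include hS h₂

lemma mapExt_injective_zero_of_X₂ : Function.Injective (F.mapExtAddHom S.X₃ Y 0) := by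
  rw [injective_iff_map_eq_zero]
  intro x hx
  have : Epi S.g := hS.epi_g
  refine Ext.precomp_mk₀_injective_of_epi Y S.g ((h₂ 0).1 ?_)
  rw [map_zero, map_zero, F.mapExtAddHom_apply]
  rw [F.mapExtAddHom_apply] at hx
  refine (Ext.mapExactFunctor_comp F _ _ (zero_add 0)).trans ?_
  rw [hx, Ext.comp_zero]

/-- A class killed by F dies on `S.X₂`, hence is a connecting image δ(y). Then F(y) extends to
F(`S.X₂`), the extension lifts to z by surjectivity on `S.X₂`, and injectivity on `S.X₁` identifies
y with the restriction of z, so δ(y) = 0. -/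
lemma mapExt_injective_succ_of_X₂ (n : ℕ) (h₁ : Function.Injective (F.mapExtAddHom S.X₁ Y n)) :
    Function.Injective (F.mapExtAddHom S.X₃ Y (n + 1)) := by
  rw [injective_iff_map_eq_zero]
  intro x hx
  obtain ⟨y, rfl⟩ := Ext.contravariant_sequence_exact₃ hS Y x (n₀ := n) (hn₀ := add_comm 1 n) (by
    apply (h₂ (n + 1)).1
    simp only [F.mapExtAddHom_apply, Ext.mapExactFunctor_comp] at hx ⊢
    rw [hx]
    simp)
  rw [F.mapExtAddHom_apply, Ext.mapExactFunctor_comp, Ext.mapExactFunctor_extClass] at hx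
  obtain ⟨z, hz⟩ := Ext.contravariant_sequence_exact₁ (hS.map_of_exact F) _ _ _ hx
  obtain ⟨z, rfl⟩ := (h₂ n).2 z
  obtain rfl : (Ext.mk₀ S.f).comp z (zero_add n) = y := by
    apply h₁
    rw [F.mapExtAddHom_apply, F.mapExtAddHom_apply, Ext.mapExactFunctor_comp,
      Ext.mapExactFunctor_mk₀]
    exact hz
  simp

/-- The part of the surjectivity argument common to all degrees: y can be corrected by a class from
A so that it vanishes on F(`S.X₂`). In degree 0 the difference is then zero; in higher degrees it is
a connecting image. -/
lemma mapExt_surjective_of_X₂ (n : ℕ) (h₁ : Function.Injective (F.mapExtAddHom S.X₁ Y n))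
    (y : Ext.{w'} (F.obj S.X₃) (F.obj Y) n) :
    ∃ x, (Ext.mk₀ (F.map S.g)).comp (y - F.mapExtAddHom S.X₃ Y n x) (zero_add n) = 0 := by
  obtain ⟨z, hz⟩ := (h₂ n).2 ((Ext.mk₀ (F.map S.g)).comp y (zero_add n))
  obtain ⟨x, hx⟩ := Ext.contravariant_sequence_exact₂ hS Y z (by
    apply h₁
    rw [map_zero, F.mapExtAddHom_apply, Ext.mapExactFunctor_comp, Ext.mapExactFunctor_mk₀]
    rw [F.mapExtAddHom_apply] at hz
    rw [hz, Ext.mk₀_comp_mk₀_assoc, ← F.map_comp, S.zero]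
    simp)
  refine ⟨x, ?_⟩
  change (Ext.mk₀ (F.map S.g)).precomp _ (zero_add n) (y - _) = 0
  rw [map_sub, sub_eq_zero]
  change (Ext.mk₀ (F.map S.g)).comp _ (zero_add n) = (Ext.mk₀ (F.map S.g)).comp _ (zero_add n)
  rw [← hz, ← hx, F.mapExtAddHom_apply, F.mapExtAddHom_apply,
    Ext.mapExactFunctor_comp, Ext.mapExactFunctor_mk₀]

lemma mapExt_surjective_zero_of_X₂ (h₁ : Function.Injective (F.mapExtAddHom S.X₁ Y 0)) :
    Function.Surjective (F.mapExtAddHom S.X₃ Y 0) := by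
  intro y
  obtain ⟨x, hx⟩ := mapExt_surjective_of_X₂ F hS Y h₂ 0 h₁ y
  have : Epi (F.map S.g) := (hS.map_of_exact F).epi_g
  have := Ext.precomp_mk₀_injective_of_epi (F.obj Y) (F.map S.g) (hx.trans (map_zero _).symm)
  exact ⟨x, (sub_eq_zero.1 this).symm⟩

lemma mapExt_surjective_succ_of_X₂ (n : ℕ) (h₁ : Function.Surjective (F.mapExtAddHom S.X₁ Y n))
    (h₁' : Function.Injective (F.mapExtAddHom S.X₁ Y (n + 1))) :
    Function.Surjective (F.mapExtAddHom S.X₃ Y (n + 1)) := by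
  intro y
  obtain ⟨x, hx⟩ := mapExt_surjective_of_X₂ F hS Y h₂ (n + 1) h₁' y
  obtain ⟨z, hz⟩ := Ext.contravariant_sequence_exact₃ (hS.map_of_exact F) _ _ hx (add_comm 1 n)
  obtain ⟨z, rfl⟩ := h₁ z
  refine ⟨hS.extClass.comp z (add_comm 1 n) + x, ?_⟩
  rw [map_add, ← eq_sub_iff_add_eq, ← hz, F.mapExtAddHom_apply, F.mapExtAddHom_apply,
    Ext.mapExactFunctor_comp, Ext.mapExactFunctor_extClass]
  rfl

end LeftDimensionShift

/-! ### The dual arguments for the covariant long exact sequence. -/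

section RightDimensionShift

variable {S : ShortComplex A} (hS : S.ShortExact) (X : A)
  (h₂ : ∀ n, Function.Bijective (F.mapExtAddHom X S.X₂ n))
include hS h₂

lemma mapExt_injective_zero_of_X₂' : Function.Injective (F.mapExtAddHom X S.X₁ 0) := by
  rw [injective_iff_map_eq_zero]
  intro x hx
  have : Mono S.f := hS.mono_f
  refine Ext.postcomp_mk₀_injective_of_mono X S.f ((h₂ 0).1 ?_)
  rw [map_zero, map_zero, F.mapExtAddHom_apply]
  rw [F.mapExtAddHom_apply] at hx
  refine (Ext.mapExactFunctor_comp F _ _ (add_zero 0)).trans ?_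
  rw [hx, Ext.zero_comp]

lemma mapExt_injective_succ_of_X₂' (n : ℕ) (h₃ : Function.Injective (F.mapExtAddHom X S.X₃ n)) :
    Function.Injective (F.mapExtAddHom X S.X₁ (n + 1)) := by
  rw [injective_iff_map_eq_zero]
  intro x hx
  obtain ⟨y, rfl⟩ := Ext.covariant_sequence_exact₁ X hS x (n₀ := n) (hn₀ := rfl) (by
    apply (h₂ (n + 1)).1
    simp only [F.mapExtAddHom_apply, Ext.mapExactFunctor_comp] at hx ⊢
    rw [hx]
    simp)
  rw [F.mapExtAddHom_apply, Ext.mapExactFunctor_comp, Ext.mapExactFunctor_extClass] at hx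
  obtain ⟨z, hz⟩ := Ext.covariant_sequence_exact₃ _ (hS.map_of_exact F) _ _ hx
  obtain ⟨z, rfl⟩ := (h₂ n).2 z
  obtain rfl : z.comp (Ext.mk₀ S.g) (add_zero n) = y := by
    apply h₃
    rw [F.mapExtAddHom_apply, F.mapExtAddHom_apply, Ext.mapExactFunctor_comp,
      Ext.mapExactFunctor_mk₀]
    exact hz
  simp

lemma mapExt_surjective_of_X₂' (n : ℕ) (h₃ : Function.Injective (F.mapExtAddHom X S.X₃ n))
    (y : Ext.{w'} (F.obj X) (F.obj S.X₁) n) :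
    ∃ x, (y - F.mapExtAddHom X S.X₁ n x).comp (Ext.mk₀ (F.map S.f)) (add_zero n) = 0 := by
  obtain ⟨z, hz⟩ := (h₂ n).2 (y.comp (Ext.mk₀ (F.map S.f)) (add_zero n))
  obtain ⟨x, hx⟩ := Ext.covariant_sequence_exact₂ X hS z (by
    apply h₃
    rw [map_zero, F.mapExtAddHom_apply, Ext.mapExactFunctor_comp, Ext.mapExactFunctor_mk₀]
    rw [F.mapExtAddHom_apply] at hz
    rw [hz, Ext.comp_assoc_of_third_deg_zero, Ext.mk₀_comp_mk₀, ← F.map_comp, S.zero]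
    simp)
  refine ⟨x, ?_⟩
  change (Ext.mk₀ (F.map S.f)).postcomp _ (add_zero n) (y - _) = 0
  rw [map_sub, sub_eq_zero]
  change Ext.comp _ (Ext.mk₀ (F.map S.f)) (add_zero n) = Ext.comp _ (Ext.mk₀ (F.map S.f)) (add_zero n)
  rw [← hz, ← hx, F.mapExtAddHom_apply, F.mapExtAddHom_apply,
    Ext.mapExactFunctor_comp, Ext.mapExactFunctor_mk₀]

lemma mapExt_surjective_zero_of_X₂' (h₃ : Function.Injective (F.mapExtAddHom X S.X₃ 0)) :
    Function.Surjective (F.mapExtAddHom X S.X₁ 0) := by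
  intro y
  obtain ⟨x, hx⟩ := mapExt_surjective_of_X₂' F hS X h₂ 0 h₃ y
  have : Mono (F.map S.f) := (hS.map_of_exact F).mono_f
  have := Ext.postcomp_mk₀_injective_of_mono (F.obj X) (F.map S.f) (hx.trans (map_zero _).symm)
  exact ⟨x, (sub_eq_zero.1 this).symm⟩

lemma mapExt_surjective_succ_of_X₂' (n : ℕ) (h₃ : Function.Surjective (F.mapExtAddHom X S.X₃ n))
    (h₃' : Function.Injective (F.mapExtAddHom X S.X₃ (n + 1))) :
    Function.Surjective (F.mapExtAddHom X S.X₁ (n + 1)) := by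
  intro y
  obtain ⟨x, hx⟩ := mapExt_surjective_of_X₂' F hS X h₂ (n + 1) h₃' y
  obtain ⟨z, hz⟩ := Ext.covariant_sequence_exact₁ _ (hS.map_of_exact F) _ hx rfl
  obtain ⟨z, rfl⟩ := h₃ z
  refine ⟨z.comp hS.extClass rfl + x, ?_⟩
  rw [map_add, ← eq_sub_iff_add_eq, ← hz, F.mapExtAddHom_apply, F.mapExtAddHom_apply,
    Ext.mapExactFunctor_comp, Ext.mapExactFunctor_extClass]
  rfl

end RightDimensionShift

/-- Let `𝒬` and `𝒥` be classes on which the exact functor `F` induces isomorphisms on all `Ext`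
groups out of `𝒬`, respectively into `𝒥`. If `X` has a partial `𝒬`-resolution with `a` terms and
`Y` a partial `𝒥`-coresolution with `b` terms, then `F` is bijective on `Extⁿ(X, Y)` for
`n + 2 ≤ a + b` and injective for `n + 1 ≤ a + b`. -/
lemma mapExt_injective_and_surjective (𝒬 𝒥 : ObjectProperty A)
    (h𝒬 : ∀ Q, 𝒬 Q → ∀ Y n, Function.Bijective (F.mapExtAddHom Q Y n))
    (h𝒥 : ∀ I, 𝒥 I → ∀ X n, Function.Bijective (F.mapExtAddHom X I n)) (a : ℕ) :
    ∀ (b : ℕ) (X Y : A) (_ : HasLeftResolution 𝒬 a X) (_ : HasRightResolution 𝒥 b Y) (n : ℕ),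
      (n + 1 ≤ a + b → Function.Injective (F.mapExtAddHom X Y n)) ∧
      (n + 2 ≤ a + b → Function.Surjective (F.mapExtAddHom X Y n)) := by
  induction a with
  | zero =>
    intro b
    induction b with
    -- Without any resolution terms both degree bounds are unsatisfiable.
    | zero => exact fun X Y _ _ n => ⟨fun h => by omega, fun h => by omega⟩
    | succ b ih =>
      rintro X _ hX ⟨S, hS, h₂, rfl, hY⟩ n
      have ih := ih X S.X₃ hX hY
      have h₂ := h𝒥 _ h₂ X
      cases n with
      | zero => exact ⟨fun _ => mapExt_injective_zero_of_X₂' F hS X h₂,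
          fun h => mapExt_surjective_zero_of_X₂' F hS X h₂ ((ih 0).1 (by omega))⟩
      | succ n => exact
          ⟨fun h => mapExt_injective_succ_of_X₂' F hS X h₂ n ((ih n).1 (by omega)),
            fun h => mapExt_surjective_succ_of_X₂' F hS X h₂ n ((ih n).2 (by omega))
              ((ih (n + 1)).1 (by omega))⟩
  | succ a ih =>
    rintro b _ Y ⟨S, hS, h₂, rfl, hX⟩ hY n
    -- The degree stays free: surjectivity in degree n + 1 consumes surjectivity in degree n and
    -- injectivity in degree n + 1 for the syzygy. Hence the two bounds differ by one.
    have ih := ih b S.X₁ Y hX hY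
    have h₂ := h𝒬 _ h₂ Y
    cases n with
    | zero => exact ⟨fun _ => mapExt_injective_zero_of_X₂ F hS Y h₂,
        fun h => mapExt_surjective_zero_of_X₂ F hS Y h₂ ((ih 0).1 (by omega))⟩
    | succ n => exact
        ⟨fun h => mapExt_injective_succ_of_X₂ F hS Y h₂ n ((ih n).1 (by omega)),
          fun h => mapExt_surjective_succ_of_X₂ F hS Y h₂ n ((ih n).2 (by omega))
            ((ih (n + 1)).1 (by omega))⟩

lemma mapExt_zero_bijective {X Y : A}
    (h : Function.Bijective (F.map : (X ⟶ Y) → (F.obj X ⟶ F.obj Y))) :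
    Function.Bijective (F.mapExtAddHom X Y 0) := by
  rw [F.mapExtAddHom_coe, Ext.mapExactFunctor₀]
  exact (Ext.homEquiv₀.symm.bijective.comp h).comp Ext.homEquiv₀.bijective

lemma mapExt_bijective_of_projective {Q : A} [Projective Q] [Projective (F.obj Q)] (Y : A)
    (h : Function.Bijective (F.map : (Q ⟶ Y) → (F.obj Q ⟶ F.obj Y))) (n : ℕ) :
    Function.Bijective (F.mapExtAddHom Q Y n) := by
  cases n with
  | zero => exact mapExt_zero_bijective F h
  | succ n => exact ⟨fun _ _ _ => (Ext.subsingleton_of_projective Q Y n).elim _ _,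
      fun _ => ⟨0, (Ext.subsingleton_of_projective (F.obj Q) (F.obj Y) n).elim _ _⟩⟩

lemma mapExt_bijective_of_injective {I : A} [Injective I] [Injective (F.obj I)] (X : A)
    (h : Function.Bijective (F.map : (X ⟶ I) → (F.obj X ⟶ F.obj I))) (n : ℕ) :
    Function.Bijective (F.mapExtAddHom X I n) := by
  cases n with
  | zero => exact mapExt_zero_bijective F h
  | succ n => exact ⟨fun _ _ _ => (Ext.subsingleton_of_injective X I n).elim _ _,
      fun _ => ⟨0, (Ext.subsingleton_of_injective (F.obj X) (F.obj I) n).elim _ _⟩⟩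

end Homological

/-! ### Passage to direct summands of finite direct sums. -/

section Additive

universe u₁ v₁ u₂ v₂

variable {A : Type u₁} [Category.{v₁} A] [Preadditive A] [HasFiniteBiproducts A]
  {B : Type u₂} [Category.{v₂} B] [Preadditive B] (F : A ⥤ B) [F.Additive]

lemma map_bijective_of_retract_biproduct_left {Q X Y : A} {m : ℕ}
    (r : Retract X (⨁ fun _ : Fin m => Q))
    (h : Function.Bijective (F.map : (Q ⟶ Y) → (F.obj Q ⟶ F.obj Y))) :
    Function.Bijective (F.map : (X ⟶ Y) → (F.obj X ⟶ F.obj Y)) := by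
  constructor
  · intro f g hfg
    rw [← cancel_epi r.r]
    refine biproduct.hom_ext' _ _ fun j => h.1 ?_
    simp only [F.map_comp, hfg]
  · intro g
    choose k hk using fun j : Fin m =>
      h.2 (F.map (biproduct.ι (fun _ : Fin m => Q) j) ≫ F.map r.r ≫ g)
    -- The decomposition of the identity of the biproduct as ∑ π ≫ ι is carried along by additivity
    -- of F.
    have hd : F.map (biproduct.desc k) = F.map r.r ≫ g := by
      have e : biproduct.desc k = ∑ j, biproduct.π (fun _ : Fin m => Q) j ≫ k j :=
        biproduct.desc_eq
      rw [e, F.map_sum]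
      simp only [F.map_comp, hk, ← Category.assoc, ← Preadditive.sum_comp]
      simp only [← F.map_comp, ← F.map_sum]
      rw [biproduct.total, Category.id_comp]
    exact ⟨r.i ≫ biproduct.desc k, by
      rw [F.map_comp, hd, ← F.map_comp_assoc, r.retract, F.map_id, Category.id_comp]⟩

lemma map_bijective_of_retract_biproduct_right {Q X Y : A} {m : ℕ}
    (r : Retract Y (⨁ fun _ : Fin m => Q))
    (h : Function.Bijective (F.map : (X ⟶ Q) → (F.obj X ⟶ F.obj Q))) :
    Function.Bijective (F.map : (X ⟶ Y) → (F.obj X ⟶ F.obj Y)) := by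
  constructor
  · intro f g hfg
    rw [← cancel_mono r.i]
    refine biproduct.hom_ext _ _ fun j => h.1 ?_
    simp only [F.map_comp, hfg]
  · intro g
    choose k hk using fun j : Fin m =>
      h.2 ((g ≫ F.map r.i) ≫ F.map (biproduct.π (fun _ : Fin m => Q) j))
    have hd : F.map (biproduct.lift k) = g ≫ F.map r.i := by
      have e : biproduct.lift k = ∑ j, k j ≫ biproduct.ι (fun _ : Fin m => Q) j :=
        biproduct.lift_eq
      rw [e, F.map_sum]
      simp only [F.map_comp, hk, Category.assoc]
      simp only [← F.map_comp, ← Preadditive.comp_sum, ← F.map_sum]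
      rw [biproduct.total, Category.comp_id]
    exact ⟨biproduct.lift k ≫ r.r, by
      rw [F.map_comp, hd, Category.assoc, ← F.map_comp, r.retract, F.map_id, Category.comp_id]⟩

lemma projective_obj_of_retract_biproduct {Q X : A} {m : ℕ}
    (r : Retract X (⨁ fun _ : Fin m => Q)) [Projective (F.obj Q)] : Projective (F.obj X) := by
  have : Projective (F.obj (⨁ fun _ : Fin m => Q)) := by
    refine ⟨fun {E Y} f e _ => ⟨∑ j, F.map (biproduct.π _ j) ≫
      Projective.factorThru (F.map (biproduct.ι (fun _ : Fin m => Q) j) ≫ f) e, ?_⟩⟩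
    simp only [Preadditive.sum_comp, Category.assoc, Projective.factorThru_comp]
    simp only [← Category.assoc, ← Preadditive.sum_comp, ← F.map_comp, ← F.map_sum]
    rw [biproduct.total, F.map_id, Category.id_comp]
  exact (r.map F).projective

lemma injective_obj_of_retract_biproduct {Q Y : A} {m : ℕ}
    (r : Retract Y (⨁ fun _ : Fin m => Q)) [Injective (F.obj Q)] : Injective (F.obj Y) := by
  have : Injective (F.obj (⨁ fun _ : Fin m => Q)) := by
    refine ⟨fun {E Y} f e _ => ⟨∑ j, Injective.factorThru (f ≫ F.map (biproduct.π _ j)) e ≫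
      F.map (biproduct.ι (fun _ : Fin m => Q) j), ?_⟩⟩
    simp only [Preadditive.comp_sum, Injective.comp_factorThru_assoc]
    simp only [Category.assoc, ← Preadditive.comp_sum, ← F.map_comp, ← F.map_sum]
    rw [biproduct.total, F.map_id, Category.comp_id]
  exact (r.map F).injective

end Additive

/-! ### Yoneda in mod(C), and the injective object dual to a representable. -/

section Yoneda

variable (R : Type v) [CommRing R] {C : Type u} [Category.{v} C] [Preadditive C] [Linear R C]
  [IsDualizingVariety R C]

variable {R} in
/-- The underlying `R`-module of `M(c)`. -/
abbrev fiber (M : FPMod R C) (c : C) : ModuleCat.{v} R := M.obj.obj.obj c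

variable {R} in
/-- The component `M(c) ⟶ N(c)` of a morphism `M ⟶ N`. -/
abbrev fiberMap {M N : FPMod R C} (g : M ⟶ N) (c : C) : fiber M c ⟶ fiber N c := g.hom.hom.app c

variable {R} in
/-- Yoneda in `mod(C)`: the morphism `P ⟶ M` attached to an element of `M(c)`. -/
def lift {M : FPMod R C} {c : C} (x : fiber M c) : proj R c ⟶ M := ObjectProperty.homMk (repHom x)

variable {R} in
/-- Yoneda in `mod(C)`: the element of `M(c)` attached to a morphism `P ⟶ M`. -/
def val {M : FPMod R C} {c : C} (f : proj R c ⟶ M) : fiber M c := repVal f.hom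

variable {R}
variable {M N : FPMod R C} {c : C}

lemma val_lift (x : fiber M c) : val (lift x) = x := repVal_repHom x

lemma lift_val (f : proj R c ⟶ M) : lift (val f) = f :=
  ObjectProperty.hom_ext _ (repHom_repVal f.hom)

lemma val_injective : Function.Injective (val : (proj R c ⟶ M) → fiber M c) :=
  fun f g h => by rw [← lift_val f, h, lift_val]

lemma val_comp (f : proj R c ⟶ M) (g : M ⟶ N) : val (f ≫ g) = (fiberMap g c).hom (val f) := rfl

lemma val_add (f g : proj R c ⟶ M) : val (f + g) = val f + val g := rfl

lemma lift_add (x y : fiber M c) : lift (x + y) = lift x + lift y :=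
  val_injective (by rw [val_add, val_lift, val_lift, val_lift])

lemma lift_comp (x : fiber M c) (g : M ⟶ N) : lift x ≫ g = lift ((fiberMap g c).hom x) :=
  val_injective (by rw [val_comp, val_lift, val_lift])

lemma lift_zero : lift (0 : fiber M c) = 0 :=
  val_injective (val_lift 0)

/-- Scalars of R act through endomorphisms of P. This is how R_P-linear maps turn out to be R-linear
on values at c. -/
lemma val_smul_comp (r : R) (f : proj R c ⟶ M) :
    val (lift (r • val (𝟙 (proj R c))) ≫ f) = r • val f := by
  rw [val_comp, val_lift, map_smul, ← val_comp, Category.id_comp]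

lemma lift_smul (r : R) (x : fiber M c) :
    lift (r • x) = lift (r • val (𝟙 (proj R c))) ≫ lift x :=
  val_injective (by rw [val_smul_comp, val_lift, val_lift])

/-- The action of `R_P` on `(P, M)` is given by precomposition. -/
lemma op_smul (p : End (proj R c)) (x : (homFrom R c).obj M) :
    MulOpposite.op p • x = ((p : proj R c ⟶ proj R c) ≫ (x : proj R c ⟶ M) : proj R c ⟶ M) := rfl

lemma homFrom_map_apply (g : M ⟶ N) (x : proj R c ⟶ M) :
    ((homFrom R c).map g).hom x = (x ≫ g : proj R c ⟶ N) := rfl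

variable (R c) in
/-- `(P, P)` is the regular `R_P`-module. -/
def homFromProjEquiv : endRing R c ≃ₗ[endRing R c] (homFrom R c).obj (proj R c) where
  toFun a := a.unop
  map_add' _ _ := rfl
  map_smul' _ _ := rfl
  invFun x := MulOpposite.op x
  left_inv _ := rfl
  right_inv _ := rfl

instance : Projective ((homFrom R c).obj (proj R c)) :=
  have := Module.Projective.of_equiv (homFromProjEquiv R c)
  (IsProjective.iff_projective _).1 this

/-- A linear map out of the regular module is determined by its value at the identity, which may be
arbitrary. -/
lemma homFrom_map_bijective_of_proj (Y : FPMod R C) :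
    Function.Bijective ((homFrom R c).map :
      (proj R c ⟶ Y) → ((homFrom R c).obj (proj R c) ⟶ (homFrom R c).obj Y)) := by
  constructor
  · intro f g h
    have := congrArg (fun t => t.hom (𝟙 (proj R c))) h
    exact (Category.id_comp f).symm.trans (this.trans (Category.id_comp g))
  · intro h
    refine ⟨h.hom (𝟙 (proj R c)), ?_⟩
    refine ModuleCat.hom_ext (LinearMap.ext fun (x : proj R c ⟶ proj R c) => ?_)
    refine (op_smul x (h.hom (𝟙 (proj R c)))).symm.trans ((map_smul h.hom _ _).symm.trans ?_)
    exact congrArg h.hom (Category.comp_id x)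

variable (R c) in
/-- `I` represents the functor `M ↦ Hom_R(M(c), E)` on `mod(C)`, through `ε : I(c) ⟶ E`. -/
def Corepresents (E : ModuleCat.{v} R) (I : FPMod R C) (ε : fiber I c ⟶ E) : Prop :=
  ∀ M : FPMod R C, Function.Bijective (fun g : M ⟶ I => fiberMap g c ≫ ε)

variable (R c) in
-- With D(I) ≅ Hom(-,c), full faithfulness of D and Yoneda over the opposite category give Hom(M,I)
-- ≅ Hom(D(I),D(M)) ≅ D(M)(c) = Hom_R(M(c),E). That E separates the elements of M(c) follows from
-- faithfulness of D.
lemma exists_corepresents : ∃ (E : ModuleCat.{v} R) (I : FPMod R C) (ε : fiber I c ⟶ E),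
    Injective E ∧ Corepresents R c E I ε ∧
    ∀ (M : FPMod R C) (x : fiber M c), (∀ ψ : fiber M c ⟶ E, ψ.hom x = 0) → x = 0 := by
  obtain ⟨E, i, h, hE, he⟩ := IsDualizingVariety.exists_duality (R := R) (C := C)
  have : HasFiniteBiproducts C := IsHomFiniteVariety.hasFiniteBiproducts R
  let D := (isFinitelyPresented R Cᵒᵖ).lift ((isFinitelyPresented R C).ι.op ⋙ dual R C E) h
  have : D.IsEquivalence := he
  let Q : FPMod R Cᵒᵖ := ⟨rep R (op c), isFinitelyPresented_rep (op c)⟩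
  let I : FPMod R C := (D.objPreimage Q).unop
  let e : D.obj (op I) ≅ Q := D.objObjPreimageIso Q
  refine ⟨E, I, repVal (R := R) e.inv.hom, hE.injective, fun M => ⟨fun f g hfg => ?_, fun ψ => ?_⟩,
    fun M x hx => ?_⟩
  · apply Quiver.Hom.op_inj
    apply D.map_injective
    rw [← cancel_epi e.inv]
    exact ObjectProperty.hom_ext _ (rep_hom_ext hfg)
  · let t : Q ⟶ D.obj (op M) :=
      ObjectProperty.homMk (repHom (R := R) (M := (D.obj (op M)).obj) (c := op c) ψ)
    obtain ⟨g, hg⟩ := D.map_surjective (e.hom ≫ t)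
    refine ⟨g.unop, ?_⟩
    have h1 : repVal (R := R) (e.inv ≫ D.map g).hom = ψ := by
      rw [hg, Iso.inv_hom_id_assoc]
      exact repVal_repHom (R := R) (M := (D.obj (op M)).obj) (c := op c) ψ
    exact h1
  -- For f : c ⟶ d and φ : M(d) ⟶ E, the functional M(f) ≫ φ on M(c) kills x, so D kills the
  -- morphism P ⟶ M attached to x.
  · have h0 : D.map (lift x).op = D.map (0 : proj R c ⟶ M).op := by
      apply ObjectProperty.hom_ext
      apply ObjectProperty.hom_ext
      ext d (φ : fiber M d.unop ⟶ E)
      change (lift x).hom.hom.app d.unop ≫ φ = (0 : proj R c ⟶ M).hom.hom.app d.unop ≫ φ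
      ext (f : c ⟶ d.unop)
      have h2 := hx (M.obj.obj.map f ≫ φ)
      refine Eq.trans h2 ?_
      exact (map_zero φ.hom).symm
    have h1 : lift x = 0 := Quiver.Hom.op_inj (D.map_injective h0)
    rw [← val_lift x, h1]
    rfl

/-! ### The R_P-module (P,I) as the coinduced module Hom_R(R_P,E). -/

namespace Corepresents

variable {E : ModuleCat.{v} R} {I : FPMod R C} {ε : fiber I c ⟶ E} (hI : Corepresents R c E I ε)
include hI

/-- The case M = P of the representation: elements of P(c) are endomorphisms p of P, and y
corresponds to the functional p ↦ ε(p ≫ y). -/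
lemma hom_ext_proj {y y' : proj R c ⟶ I}
    (h : ∀ p : proj R c ⟶ proj R c, ε.hom (val (p ≫ y)) = ε.hom (val (p ≫ y'))) : y = y' := by
  refine (hI (proj R c)).1 ?_
  ext q
  have := h (lift q)
  rwa [val_comp, val_comp, val_lift] at this

lemma homFrom_map_bijective (X : FPMod R C) :
    Function.Bijective ((homFrom R c).map :
      (X ⟶ I) → ((homFrom R c).obj X ⟶ (homFrom R c).obj I)) := by
  constructor
  · intro f g h
    refine (hI X).1 ?_
    ext x
    have := congrArg (fun t => val (t.hom (lift x))) h
    simp only [homFrom_map_apply, val_comp, val_lift] at this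
    exact congrArg ε.hom this
  · intro h
    have hsmul (p : proj R c ⟶ proj R c) (x : proj R c ⟶ X) :
        h.hom (p ≫ x : proj R c ⟶ X) = (p ≫ (h.hom x : proj R c ⟶ I) : proj R c ⟶ I) :=
      map_smul h.hom (MulOpposite.op p : endRing R c) x
    -- As for coinduced modules, an R_P-linear h into (P,I) is recovered from the R-linear
    -- functional ε ∘ h on X(c), and that functional comes from a morphism X ⟶ I.
    obtain ⟨g, hg⟩ := (hI X).2 (ModuleCat.ofHom
      { toFun := fun x => ε.hom (val (h.hom (lift x) : proj R c ⟶ I))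
        map_add' := fun x y => by
          rw [lift_add]
          exact (congrArg (fun t => ε.hom (val t)) (map_add h.hom (lift x) (lift y))).trans
            (map_add ε.hom _ _)
        map_smul' := fun r x => by
          rw [lift_smul, hsmul]
          exact (congrArg ε.hom (val_smul_comp r _)).trans (map_smul ε.hom _ _) })
    refine ⟨g, ?_⟩
    ext (x : proj R c ⟶ X)
    rw [homFrom_map_apply]
    refine hI.hom_ext_proj fun p => ?_
    have := congrArg (fun t => t.hom (val (p ≫ x))) hg
    refine Eq.trans this ?_
    change ε.hom (val (h.hom (lift (val (p ≫ x))) : proj R c ⟶ I)) = _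
    rw [lift_val, hsmul]

/-- Baer's criterion, reduced to injectivity of E over R: a map from a left ideal to (P,I) amounts
to a functional on the corresponding R-submodule of P(c). -/
lemma injective_homFrom_obj [Injective E] : Injective ((homFrom R c).obj I) := by
  have : Module.Injective R E := Module.injective_module_of_injective_object R E
  have hB : Module.Baer (endRing R c) ((homFrom R c).obj I) := by
    intro 𝔞 h
    have hsmul (p : proj R c ⟶ proj R c) (a : 𝔞) :
        h (MulOpposite.op p • a) = (p ≫ (h a : proj R c ⟶ I) : proj R c ⟶ I) :=
      map_smul h (MulOpposite.op p : endRing R c) a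
    have hmem (r : R) (q : fiber (proj R c) c) :
        (MulOpposite.op (lift (r • q)) : endRing R c) =
          (MulOpposite.op (lift (r • val (𝟙 (proj R c)))) : endRing R c) *
            (MulOpposite.op (lift q) : endRing R c) := by
      rw [lift_smul]; rfl
    let S : Submodule R (fiber (proj R c) c) :=
      { carrier := {q | (MulOpposite.op (lift q) : endRing R c) ∈ 𝔞}
        add_mem' := fun {p q} hp hq => by
          change (MulOpposite.op (lift (p + q)) : endRing R c) ∈ 𝔞
          rw [lift_add]
          exact 𝔞.add_mem hp hq
        zero_mem' := by
          change (MulOpposite.op (lift 0) : endRing R c) ∈ 𝔞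
          rw [lift_zero]
          exact 𝔞.zero_mem
        smul_mem' := fun r q hq => by
          change (MulOpposite.op (lift (r • q)) : endRing R c) ∈ 𝔞
          rw [hmem]
          exact 𝔞.mul_mem_left _ hq }
    let φ : S →ₗ[R] E :=
      { toFun := fun q => ε.hom (val (h ⟨MulOpposite.op (lift q.1), q.2⟩ : proj R c ⟶ I))
        map_add' := fun p q => by
          have e : (⟨MulOpposite.op (lift (p + q).1), (p + q).2⟩ : 𝔞) =
              ⟨MulOpposite.op (lift p.1), p.2⟩ + ⟨MulOpposite.op (lift q.1), q.2⟩ :=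
            Subtype.ext (congrArg MulOpposite.op (lift_add p.1 q.1))
          rw [e, map_add]
          exact map_add ε.hom _ _
        map_smul' := fun r q => by
          have e : (⟨MulOpposite.op (lift (r • q).1), (r • q).2⟩ : 𝔞) =
              (MulOpposite.op (lift (r • val (𝟙 (proj R c)))) : endRing R c) •
                ⟨MulOpposite.op (lift q.1), q.2⟩ :=
            Subtype.ext (hmem r q.1)
          rw [e, hsmul]
          exact (congrArg ε.hom (val_smul_comp r _)).trans (map_smul ε.hom _ _) }
    obtain ⟨ψ, hψ⟩ := Module.Injective.out S.subtype S.subtype_injective φ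
    obtain ⟨y, hy⟩ := (hI (proj R c)).2 (ModuleCat.ofHom ψ)
    -- The extended functional on P(c) comes from some y : P ⟶ I, and y is the value at 1 of the
    -- required extension.
    refine ⟨LinearMap.toSpanSingleton _ _ (y : (homFrom R c).obj I), fun a ha => ?_⟩
    change (a.unop : proj R c ⟶ proj R c) ≫ y = _
    refine hI.hom_ext_proj fun p => ?_
    have e : (MulOpposite.op p • (⟨a, ha⟩ : 𝔞)).1 =
        MulOpposite.op (lift (val (p ≫ (a.unop : proj R c ⟶ proj R c)))) := by
      rw [lift_val]; rfl
    have hS : val (p ≫ (a.unop : proj R c ⟶ proj R c)) ∈ S := by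
      change MulOpposite.op (lift _) ∈ 𝔞
      rw [← e]
      exact Subtype.prop _
    have h1 := congrArg (fun t => t.hom (val (p ≫ (a.unop : proj R c ⟶ proj R c)))) hy
    refine Eq.trans h1 ((hψ ⟨_, hS⟩).trans ?_)
    rw [← hsmul]
    exact congrArg (fun t => ε.hom (val (h t : proj R c ⟶ I))) (Subtype.ext e.symm)
  have := hB.injective
  exact (Module.injective_iff_injective_object (endRing R c) ((homFrom R c).obj I)).1 this

end Corepresents

end Yoneda

/-! ### Submodules of P/rad P are detected at c. -/

section Radical

variable {R : Type v} [CommRing R] {C : Type u} [Category.{v} C] [Preadditive C] [Linear R C]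

/-- Every nonzero submodule of `P / rad P`, `P = Hom_C(c, -)`, has a nonzero value at `c`. -/
lemma IsRad.eq_zero_of_forall_comp_eq_zero {c d : C} {N : Subobject (rep R c)}
    (hN : IsRad (rep R c) N) (x : rep R d ⟶ cokernel N.arrow)
    (hx : ∀ f : rep R c ⟶ rep R d, f ≫ x = 0) : x = 0 := by
  let x' := Projective.factorThru x (cokernel.π N.arrow)
  have hx' : x' ≫ cokernel.π N.arrow = x := Projective.factorThru_comp _ _
  suffices h : imageSubobject x' ≤ N by
    rw [← hx', ← imageSubobject_arrow_comp x', ← Subobject.ofLE_arrow h, Category.assoc,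
      Category.assoc, cokernel.condition, comp_zero, comp_zero]
  refine hN.2 fun K hK => ?_
  by_contra hxK
  -- L is the sum of K and the image of x'. If K misses that image, maximality forces L to be all of
  -- P.
  let L := imageSubobject (biprod.desc K.arrow x')
  have hL : factorThruImageSubobject (biprod.desc K.arrow x') ≫ L.arrow = _ :=
    imageSubobject_arrow_comp _
  have hKL : K ≤ L := Subobject.le_of_comm
    (biprod.inl ≫ factorThruImageSubobject (biprod.desc K.arrow x')) (by simp [hL])
  have hxL : imageSubobject x' ≤ L :=
    imageSubobject_le _ (biprod.inr ≫ factorThruImageSubobject (biprod.desc K.arrow x')) (by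
      rw [Category.assoc, hL, biprod.inr_desc])
  have hLtop : L = ⊤ := hK.2 L (lt_of_le_of_ne hKL fun h => hxK (h ▸ hxL))
  have hiso : IsIso L.arrow := (Subobject.isIso_iff_mk_eq_top L.arrow).2 (by simpa using hLtop)
  have hepi : Epi (biprod.desc K.arrow x') := by
    rw [← hL]
    exact epi_comp _ _
  -- Projectivity of P writes its identity as a map through K plus a map through x'. By `hx` the
  -- second summand lands in N ≤ K, so K would be all of P.
  let s := Projective.factorThru (𝟙 (rep R c)) (biprod.desc K.arrow x')
  have hs : s ≫ biprod.desc K.arrow x' = 𝟙 _ := Projective.factorThru_comp _ _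
  have hs2 : ((s ≫ biprod.snd) ≫ x') ≫ cokernel.π N.arrow = 0 := by
    rw [Category.assoc, hx', hx]
  let t := (ShortComplex.exact_cokernel N.arrow).lift _ hs2
  have ht : t ≫ N.arrow = (s ≫ biprod.snd) ≫ x' := (ShortComplex.exact_cokernel N.arrow).lift_f _ hs2
  have hNK : N ≤ K := hN.1 hK
  have hid : (s ≫ biprod.fst + t ≫ Subobject.ofLE N K hNK) ≫ K.arrow = 𝟙 _ := by
    rw [Preadditive.add_comp, Category.assoc, Category.assoc, Subobject.ofLE_arrow, ht, ← hs,
      biprod.desc_eq]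
    simp
  refine hK.1 ?_
  have : IsSplitEpi K.arrow := ⟨⟨⟨_, hid⟩⟩⟩
  have : IsIso K.arrow := isIso_of_mono_of_isSplitEpi _
  exact Subobject.eq_top_of_isIso_arrow K

end Radical

/-! ### The injective envelope of P/rad P is a summand of a power of I. -/

section Socle

variable {R : Type v} [CommRing R] {C : Type u} [Category.{v} C] [Preadditive C] [Linear R C]
  [IsDualizingVariety R C]

lemma fiberMap_injective_of_mono {M N : FPMod R C} (f : M ⟶ N) [Mono f] (c : C) :
    Function.Injective (fiberMap f c).hom := by
  rw [injective_iff_map_eq_zero]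
  intro x hx
  have : lift x = 0 := by
    rw [← cancel_mono f, lift_comp, hx, lift_zero, zero_comp]
  rw [← val_lift x, this]
  rfl

variable {c : C} {E : ModuleCat.{v} R} {I : FPMod R C} {ε : fiber I c ⟶ E}

/-- Hom(-,I) is evaluation at c, which preserves monomorphisms, followed by Hom_R(-,E). -/
lemma Corepresents.injective (hI : Corepresents R c E I ε) [Injective E] : Injective I where
  factors {X Y} g f _ := by
    have : Mono (fiberMap f c) :=
      (ModuleCat.mono_iff_injective _).2 (fiberMap_injective_of_mono f c)
    obtain ⟨g', hg'⟩ := (hI Y).2 (Injective.factorThru (fiberMap g c ≫ ε) (fiberMap f c))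
    refine ⟨g', (hI X).1 ?_⟩
    change (fiberMap f c ≫ fiberMap g' c) ≫ ε = fiberMap g c ≫ ε
    rw [Category.assoc]
    exact (congrArg (fun t => fiberMap f c ≫ t) hg').trans (Injective.comp_factorThru _ _)

variable [IsArtinianRing R]

lemma Corepresents.exists_mono_top (hI : Corepresents R c E I ε)
    (hE : ∀ (M : FPMod R C) (x : fiber M c), (∀ ψ : fiber M c ⟶ E, ψ.hom x = 0) → x = 0)
    {N : Subobject (proj R c).obj} (hN : IsRad (proj R c).obj N) {T : FPMod R C}
    (e : T.obj ≅ cokernel N.arrow) :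
    ∃ (m : ℕ) (g : T ⟶ ⨁ fun _ : Fin m => I), Mono g := by
  have : IsArtinian R (fiber T c) := by
    have : Module.Finite R (fiber (proj R c) c) :=
      IsHomFiniteVariety.finite_hom (R := R) (C := C) c c
    have : Module.Finite R (fiber T c) := Module.Finite.of_surjective
      (((cokernel.π N.arrow ≫ e.inv).hom.app c).hom) (surjective_of_epi _ c)
    infer_instance
  -- The artinian property gives finitely many maps T ⟶ I whose common kernel at c lies in the
  -- kernel at c of every such map; that common kernel is zero because E separates T(c).
  obtain ⟨t, ht⟩ := Finset.exists_inf_le (fun g : T ⟶ I => LinearMap.ker (fiberMap g c).hom)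
  let g : T ⟶ ⨁ fun _ : Fin t.card => I := biproduct.lift fun j => (t.equivFin.symm j).1
  refine ⟨t.card, g, Preadditive.mono_of_cancel_zero _ fun {Z} z hz => ?_⟩
  apply ObjectProperty.hom_ext
  refine mod_hom_ext fun d x => ?_
  rw [← cancel_mono e.hom]
  change (x ≫ z.hom) ≫ e.hom = (x ≫ 0) ≫ e.hom
  rw [comp_zero, zero_comp]
  refine IsRad.eq_zero_of_forall_comp_eq_zero hN _ fun f => ?_
  let y : proj R c ⟶ T := (ObjectProperty.homMk (f ≫ x) : proj R c ⟶ Z) ≫ z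
  have hy : y ≫ g = 0 := by rw [Category.assoc, hz, comp_zero]
  have hmem : val y ∈ t.inf fun g : T ⟶ I => LinearMap.ker (fiberMap g c).hom := by
    rw [Submodule.mem_finsetInf]
    intro k hk
    have h1 : y ≫ k = 0 := by
      have := hy =≫ biproduct.π (fun _ : Fin t.card => I) (t.equivFin ⟨k, hk⟩)
      simpa [g] using this
    rw [LinearMap.mem_ker, ← val_comp, h1]
    rfl
  have hy0 : y = 0 := by
    rw [← lift_val y, hE T (val y) fun ψ => ?_, lift_zero]
    obtain ⟨k, rfl⟩ := (hI T).2 ψ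
    have := ht k hmem
    rw [LinearMap.mem_ker] at this
    change ε.hom ((fiberMap k c).hom (val y)) = 0
    rw [this, map_zero]
  have h2 : (f ≫ x) ≫ z.hom = 0 := congrArg (fun t => t.hom) hy0
  rw [Category.assoc] at h2
  exact (Category.assoc f (x ≫ z.hom) e.hom).symm.trans ((h2 =≫ e.hom).trans zero_comp)

/-- An embedding of P/rad P in a power of I extends to J by injectivity of that power. The extension
is mono by essentiality and splits because J is injective. -/
lemma Corepresents.isInAdd (hI : Corepresents R c E I ε) [Injective E]
    (hE : ∀ (M : FPMod R C) (x : fiber M c), (∀ ψ : fiber M c ⟶ E, ψ.hom x = 0) → x = 0)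
    {J : FPMod R C} (hJ : IsInjectiveEnvelopeOfTop (proj R c) J) : IsInAdd I J := by
  obtain ⟨N, hN, T, e, i, hi⟩ := hJ
  obtain ⟨m, g, hg⟩ := hI.exists_mono_top hE hN e
  have := hi.mono
  have := hi.injective
  have : Injective I := hI.injective
  have : Injective (⨁ fun _ : Fin m => I) :=
    injective_obj_of_retract_biproduct (𝟭 _) (Retract.refl _)
  have hm : Mono (Injective.factorThru g i) :=
    hi.essential _ (by rwa [Injective.comp_factorThru])
  exact ⟨m, ⟨{ i := Injective.factorThru g i
               r := Injective.factorThru (𝟙 J) (Injective.factorThru g i)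
               retract := Injective.comp_factorThru _ _ }⟩⟩

end Socle

/-! ### Ext comparison for add(P) and add(J), and the degree count. -/

section Main

variable {R : Type v} [CommRing R] {C : Type u} [Category.{v} C] [Preadditive C] [Linear R C]
  [IsDualizingVariety R C] {c : C}

lemma extMap_bijective_of_isInAdd_proj [HasExt.{w} (FPMod R C)]
    [HasExt.{w'} (ModuleCat.{max u v} (endRing R c))] {Q : FPMod R C}
    (hQ : IsInAdd (proj R c) Q) (Y : FPMod R C) (n : ℕ) :
    Function.Bijective (extMap R c Q Y n) := by
  obtain ⟨m, ⟨r⟩⟩ := hQ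
  have : Projective Q := projective_obj_of_retract_biproduct (𝟭 _) r
  have : Projective ((homFrom R c).obj Q) := projective_obj_of_retract_biproduct _ r
  exact mapExt_bijective_of_projective _ Y
    (map_bijective_of_retract_biproduct_left _ r (homFrom_map_bijective_of_proj Y)) n

lemma extMap_bijective_of_isInAdd_injectiveEnvelope [IsArtinianRing R] [HasExt.{w} (FPMod R C)]
    [HasExt.{w'} (ModuleCat.{max u v} (endRing R c))] {J K : FPMod R C}
    (hJ : IsInjectiveEnvelopeOfTop (proj R c) J) (hK : IsInAdd J K) (X : FPMod R C) (n : ℕ) :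
    Function.Bijective (extMap R c X K n) := by
  obtain ⟨E, I, ε, hE, hI, hE'⟩ := exists_corepresents R c
  obtain ⟨m, ⟨r⟩⟩ := hI.isInAdd hE' hJ
  obtain ⟨l, ⟨r'⟩⟩ := hK
  have : Injective I := hI.injective
  have : Injective J := injective_obj_of_retract_biproduct (𝟭 _) r
  have : Injective K := injective_obj_of_retract_biproduct (𝟭 _) r'
  have := hI.injective_homFrom_obj
  have : Injective ((homFrom R c).obj J) := injective_obj_of_retract_biproduct _ r
  have : Injective ((homFrom R c).obj K) := injective_obj_of_retract_biproduct _ r'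
  exact mapExt_bijective_of_injective _ X (map_bijective_of_retract_biproduct_right _ r'
    (map_bijective_of_retract_biproduct_right _ r (hI.homFrom_map_bijective X))) n

lemma extMap_bijective_of_hasResolution [IsArtinianRing R] [HasExt.{w} (FPMod R C)]
    [HasExt.{w'} (ModuleCat.{max u v} (endRing R c))] {X Y : FPMod R C} {a b n : ℕ}
    (hX : HasLeftResolution (IsInAdd (proj R c)) a X)
    (hY : HasRightResolution
      (fun K => ∃ J, IsInjectiveEnvelopeOfTop (proj R c) J ∧ IsInAdd J K) b Y)
    (h : n + 2 ≤ a + b) : Function.Bijective (extMap R c X Y n) := by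
  have := mapExt_injective_and_surjective.{w, w'} (homFrom R c) _ _
    (fun Q hQ => extMap_bijective_of_isInAdd_proj hQ)
    (fun K ⟨J, hJ, hK⟩ => extMap_bijective_of_isInAdd_injectiveEnvelope hJ hK) a b X Y hX hY n
  exact ⟨this.1 (by omega), this.2 h⟩

/-- The indices 0, …, m make m + 1 terms. -/
lemma projClass.hasLeftResolution {P X : FPMod R C} {k : ℕ∞} (hX : projClass P k X) (m : ℕ)
    (hm : (m : ℕ∞) ≤ k) : HasLeftResolution (IsInAdd P) (m + 1) X := by
  obtain ⟨Q, hQ⟩ := hX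
  exact .of_projectiveResolution _ Q fun i hi =>
    hQ i (le_trans (by exact_mod_cast Nat.lt_succ_iff.1 hi) hm)

lemma injClass.hasRightResolution {P Y : FPMod R C} {k : ℕ∞} (hY : injClass P k Y) (m : ℕ)
    (hm : (m : ℕ∞) ≤ k) :
    HasRightResolution (fun K => ∃ J, IsInjectiveEnvelopeOfTop P J ∧ IsInAdd J K) (m + 1) Y := by
  obtain ⟨J, hJ, I, hI⟩ := hY
  exact .of_injectiveResolution _ I fun i hi =>
    ⟨J, hJ, hI i (le_trans (by exact_mod_cast Nat.lt_succ_iff.1 hi) hm)⟩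

end Main

/-- An infinite bound can be replaced by n, with 0 on the other side. -/
lemma exists_natCast_le_of_le_add {i j : ℕ∞} {n : ℕ} (h : (n : ℕ∞) ≤ i + j) :
    ∃ a b : ℕ, (a : ℕ∞) ≤ i ∧ (b : ℕ∞) ≤ j ∧ n ≤ a + b := by
  induction i using ENat.recTopCoe with
  | top => exact ⟨n, 0, le_top, by simp, by simp⟩
  | coe i =>
    induction j using ENat.recTopCoe with
    | top => exact ⟨0, n, by simp, le_top, by simp⟩
    | coe j => exact ⟨i, j, le_rfl, le_rfl, by exact_mod_cast h⟩

end DualVar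

end

theorem mainTheorem10 {R : Type v} [CommRing R] [IsArtinianRing R]
    {C : Type u} [Category.{v} C] [Preadditive C] [Linear R C]
    [DualVar.IsDualizingVariety R C] [HasExt.{w} (DualVar.FPMod R C)]
    (c : C) [HasExt.{w'} (ModuleCat.{max u v} (DualVar.endRing R c))]
    (X Y : DualVar.FPMod R C) (n : ℕ) :
    (∀ i j : ℕ∞, DualVar.projClass (DualVar.proj R c) i X →
        DualVar.injClass (DualVar.proj R c) j Y → (n : ℕ∞) ≤ i + j →
        Function.Bijective (DualVar.extMap R c X Y n)) ∧
      (DualVar.injClass (DualVar.proj R c) ((n + 1 : ℕ) : ℕ∞) Y →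
        Function.Bijective (DualVar.extMap R c X Y n)) ∧
      (DualVar.projClass (DualVar.proj R c) ((n + 1 : ℕ) : ℕ∞) X →
        Function.Bijective (DualVar.extMap R c X Y n)) := by

  refine ⟨fun i j hX hY h => ?_, fun hY => ?_, fun hX => ?_⟩
  · obtain ⟨a, b, ha, hb, hab⟩ := DualVar.exists_natCast_le_of_le_add h
    -- There are a + 1 and b + 1 terms, so n ≤ a + b is exactly what the surjectivity bound asks
    -- for.
    exact DualVar.extMap_bijective_of_hasResolution (hX.hasLeftResolution a ha)
      (hY.hasRightResolution b hb) (by omega)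
  -- The indices 0, …, n + 1 on one side alone supply the n + 2 terms.
  · exact DualVar.extMap_bijective_of_hasResolution (a := 0) trivial
      (hY.hasRightResolution (n + 1) le_rfl) (by omega)
  · exact DualVar.extMap_bijective_of_hasResolution (b := 0) (hX.hasLeftResolution (n + 1) le_rfl)
      trivial (by omega)
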